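/- Let $X$ be a finite alphabet, $X^*$ the rooted tree of finite words over $X$ (a word $w$ is joined to the words $wx$, $x\in X$), and $X^{-\omega}$ the space of left-infinite words $\dots x_2x_1$ with the product topology. Let $(G,X)$ be a contracting self-similar action. That is, $G$ is a group acting faithfully by automorphisms of $X^*$; for all $g\in G$, $x\in X$ there are (unique) $g(x)\in X$ and $g|_x\in G$ with $g(xw)=g(x)\,g|_x(w)$ for all $w\in X^*$; and, writing $g|_\varnothing=g$ and $g|_{xw}=(g|_x)|_w$, there is a finite set $\mathcal N\subset G$ such that for every $g\in G$ there is $k$ with $g|_w\in\mathcal N$ whenever $|w|\ge k$. The smallest such $\mathcal N$ is the nucleus. Its Moore diagram has vertex set $\mathcal N$ and, for every $q\in\mathcal N$ and $x\in X$, an arrow from $q$ to $q|_x$ labeled $(x,q(x))$. Words $\dots x_2x_1$ and $\dots y_2y_1$ are asymptotically equivalent if there are $g_k\in G$ $(k\ge1)$, taking only finitely many values, with $g_k(x_k\dots x_1)=y_k\dots y_1$ for all $k\ge1$. The limit space $\mathcal J_G$ is the quotient of $X^{-\omega}$ by this relation, with quotient map $p$. A self-similar structure on a compact metrizable space $K$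 consists of continuous injections $F_i:K\to K$ $(i\in X)$ for which there is a (necessarily unique) continuous surjection $\pi:X^{-\omega}\to K$ with $F_i(\pi(u))=\pi(ui)$ for all $i\in X$, $u\in X^{-\omega}$. Its critical set is $\mathcal C=\pi^{-1}\bigl(\bigcup_{i\ne j}F_i(K)\cap F_j(K)\bigr)$ and its post-critical set is $\mathcal P=\bigcup_{n\ge1}\sigma^n(\mathcal C)$, where $\sigma(\dots x_2x_1)=\dots x_3x_2$. The structure is post-critically finite (p.c.f.) if $\mathcal P$ is finite. Theorem. Suppose that $\mathcal L=(\mathcal J_G,X,\{F_i\}_{i\in X})$ is the self-similar structure on the limit space of the contracting action $(G,X)$, i.e. a self-similar structure on $\mathcal J_G$ whose associated surjection $\pi$ is the quotient map $p$. Then $\mathcal L$ is p.c.f. if and only if the action $(G,X)$ is p.c.f., meaning that there are only finitely many left-infinite paths $\dots e_2e_1$ in the Moore diagram of the nucleus that end at a non-trivial state. -/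

import Mathlib

open Topology

namespace SelfSimilar

/-! ## Self-similar actions

A finite word `x_n … x_2 x_1` over the alphabet `X` is the list `[x_n, …, x_2, x_1]`; its
head `x_n` is the letter next to the root of the tree, the one that an automorphism reads first. -/

section Actions

/-- The rooted tree of finite words over `X`: a word `w` is joined to the words `w x`, `x ∈ X`. -/
def wordTree (X : Type*) : SimpleGraph (List X) where
  Adj u v := (∃ x, v = u ++ [x]) ∨ (∃ x, u = v ++ [x])
  symm := ⟨fun _ _ h => h.symm⟩
  loopless := ⟨by
    rintro u (⟨x, h⟩ | ⟨x, h⟩) <;> simpa using congrArg List.length h⟩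

/-- A self-similar action of the group `G` over the alphabet `X`: a faithful action of `G` by
automorphisms of the rooted tree of words such that for all `g ∈ G` and `x ∈ X` there are `h ∈ G`
and `y ∈ X` with `g (x w) = y h(w)` for every word `w`. -/
class IsSelfSimilarAction (G X : Type*) [Group G] [MulAction G (List X)] : Prop
    extends FaithfulSMul G (List X) where
  smul_nil : ∀ g : G, g • ([] : List X) = []
  smul_adj : ∀ (g : G) (u v : List X), (wordTree X).Adj u v → (wordTree X).Adj (g • u) (g • v)
  exists_restriction : ∀ (g : G) (x : X), ∃ (h : G) (y : X), ∀ w : List X,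
    g • (x :: w) = y :: (h • w)

variable {G X : Type*} [Group G] [MulAction G (List X)] [IsSelfSimilarAction G X]

/-- The restriction `g|_x`. -/
noncomputable def restrict (g : G) (x : X) : G :=
  (IsSelfSimilarAction.exists_restriction g x).choose

/-- The image `g(x)` of the letter `x` under the root permutation of `g`. -/
noncomputable def rootPerm (g : G) (x : X) : X :=
  (IsSelfSimilarAction.exists_restriction g x).choose_spec.choose

theorem smul_cons (g : G) (x : X) (w : List X) :
    g • (x :: w) = rootPerm g x :: (restrict g x • w) :=
  (IsSelfSimilarAction.exists_restriction g x).choose_spec.choose_spec w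

/-- The letter `y` and the element `h` with `g (x w) = y h(w)` for all `w` are unique. -/
theorem restrict_unique {g h : G} {x y : X} (H : ∀ w : List X, g • (x :: w) = y :: (h • w)) :
    y = rootPerm g x ∧ h = restrict g x := by
  have key : ∀ w : List X, y = rootPerm g x ∧ h • w = restrict g x • w := fun w => by
    have := (H w).symm.trans (smul_cons g x w)
    exact List.cons.inj this
  exact ⟨(key []).1, FaithfulSMul.eq_of_smul_eq_smul fun w => (key w).2⟩

/-- The restriction `g|_w` to a word, with `g|_∅ = g` and `g|_{xw} = (g|_x)|_w`. -/
noncomputable def restrictWord (g : G) : List X → G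
  | [] => g
  | x :: w => restrictWord (restrict g x) w

/-- The set `N` absorbs the restrictions of `g` for every `g`: there is a `k` with `g|_w ∈ N` for
all words `w` of length at least `k`. -/
def Absorbs (X : Type*) [MulAction G (List X)] [IsSelfSimilarAction G X] (N : Set G) : Prop :=
  ∀ g : G, ∃ k : ℕ, ∀ w : List X, k ≤ w.length → restrictWord g w ∈ N

variable (G X)

/-- A self-similar action is contracting if some finite set absorbs all restrictions. -/
class IsContracting : Prop where
  exists_finite_absorbs : ∃ N : Set G, N.Finite ∧ Absorbs X N

/-- The nucleus of a contracting action: the smallest finite absorbing set (see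
`isLeast_nucleus`). -/
def nucleus : Set G := ⋂₀ {N : Set G | N.Finite ∧ Absorbs X N}

theorem isLeast_nucleus [IsContracting G X] :
    IsLeast {N : Set G | N.Finite ∧ Absorbs X N} (nucleus G X) := by
  refine ⟨⟨?_, ?_⟩, fun N hN => Set.sInter_subset_of_mem hN⟩
  · obtain ⟨N, hN⟩ := IsContracting.exists_finite_absorbs (G := G) (X := X)
    exact hN.1.subset (Set.sInter_subset_of_mem hN)
  · obtain ⟨M, hM⟩ := IsContracting.exists_finite_absorbs (G := G) (X := X)
    intro g
    have hex : ∀ a ∈ M, a ∉ nucleus G X → ∃ k : ℕ, ∀ w : List X, k ≤ w.length →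
        restrictWord g w ≠ a := by
      intro a _ ha
      simp only [nucleus, Set.mem_sInter, not_forall] at ha
      obtain ⟨N, hN, haN⟩ := ha
      obtain ⟨k, hk⟩ := hN.2 g
      exact ⟨k, fun w hw h => haN (h ▸ hk w hw)⟩
    choose! k hk using hex
    obtain ⟨k₀, hk₀⟩ := hM.2 g
    obtain ⟨K, hK⟩ := (hM.1.image k).bddAbove
    refine ⟨max k₀ K, fun w hw => ?_⟩
    by_contra hcon
    have hmem := hk₀ w (le_trans (le_max_left _ _) hw)
    exact hk _ hmem hcon w
      (le_trans (hK (Set.mem_image_of_mem k hmem)) (le_trans (le_max_right _ _) hw)) rfl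

variable {G}

/-- An arrow of the Moore diagram of a set `S` of states: for `x ∈ X` and `q ∈ S` with
`q|_x ∈ S` there is an arrow from `q` to `q|_x`. -/
@[ext]
structure MooreArrow (S : Set G) where
  source : G
  letter : X
  source_mem : source ∈ S
  restrict_mem : restrict source letter ∈ S

variable {X}

/-- The end `q|_x` of an arrow. -/
noncomputable def MooreArrow.target {S : Set G} (e : MooreArrow X S) : G :=
  restrict e.source e.letter

/-- The label `(x, q(x))` of an arrow. -/
noncomputable def MooreArrow.label {S : Set G} (e : MooreArrow X S) : X × X :=
  (e.letter, rootPerm e.source e.letter)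

variable (X)

/-- The left-infinite paths `… e_2 e_1` in the Moore diagram of `S`: the arrow `e_{n+1}` ends at
the state where `e_n` starts.  The arrow `e_{n+1}` is stored at the index `n`, so that the path
ends at the state `(e 0).target`. -/
def leftInfinitePaths (S : Set G) : Set (ℕ → MooreArrow X S) :=
  {e | ∀ n, (e (n + 1)).target = (e n).source}

variable (G)

/-- A contracting action is post-critically finite if there are only finitely many left-infinite
paths in the Moore diagram of its nucleus that end at a non-trivial state. -/
def IsPostCriticallyFiniteAction : Prop :=
  {e ∈ leftInfinitePaths X (nucleus G X) | (e 0).target ≠ 1}.Finite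

end Actions

/-! ## Left-infinite words -/

section Words

/-- The left-infinite words `… x_2 x_1` over `X`; the letter `x_{n+1}` is stored at the
index `n`. -/
def LeftWord (X : Type*) : Type _ := ℕ → X

variable {X : Type*}

/-- The product topology, the alphabet being discrete. -/
instance : TopologicalSpace (LeftWord X) :=
  @Pi.topologicalSpace ℕ (fun _ => X) (fun _ => ⊥)

/-- The finite word `x_k … x_2 x_1`. -/
def LeftWord.suffix (x : LeftWord X) : ℕ → List X
  | 0 => []
  | k + 1 => x k :: x.suffix k

/-- The word `… x_2 x_1 i`. -/
def LeftWord.append (i : X) (x : LeftWord X) : LeftWord X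
  | 0 => i
  | n + 1 => x n

/-- The shift map `… x_2 x_1 ↦ … x_3 x_2`. -/
def LeftWord.shift (x : LeftWord X) : LeftWord X := fun n => x (n + 1)

theorem LeftWord.suffix_length (x : LeftWord X) (k : ℕ) : (x.suffix k).length = k := by
  induction k with
  | zero => rfl
  | succ k ih => simp [LeftWord.suffix, ih]

instance [Finite X] : CompactSpace (LeftWord X) := by
  let : TopologicalSpace X := ⊥
  exact inferInstanceAs (CompactSpace (ℕ → X))

instance : T2Space (LeftWord X) := by
  let : TopologicalSpace X := ⊥
  have : DiscreteTopology X := ⟨rfl⟩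
  exact inferInstanceAs (T2Space (ℕ → X))

instance [Finite X] : SecondCountableTopology (LeftWord X) := by
  let : TopologicalSpace X := ⊥
  have : DiscreteTopology X := ⟨rfl⟩
  exact inferInstanceAs (SecondCountableTopology (ℕ → X))

theorem LeftWord.isLocallyConstant_suffix (k : ℕ) :
    IsLocallyConstant (fun x : LeftWord X => x.suffix k) := by
  let : TopologicalSpace X := ⊥
  have : DiscreteTopology X := ⟨rfl⟩
  let : TopologicalSpace (List X) := ⊥
  have : DiscreteTopology (List X) := ⟨rfl⟩
  rw [IsLocallyConstant.iff_continuous]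
  induction k with
  | zero => exact continuous_const
  | succ k ih =>
    have h1 : Continuous fun x : LeftWord X => x k := continuous_apply (A := fun _ : ℕ => X) k
    have h2 : Continuous fun p : X × List X => p.1 :: p.2 := continuous_of_discreteTopology
    exact h2.comp (h1.prodMk ih)

end Words

/-! ## The limit space -/

section LimitSpace

variable (G X : Type*) [Group G] [MulAction G (List X)]

/-- Two left-infinite words `… x_2 x_1` and `… y_2 y_1` are asymptotically equivalent if there are
`g_k ∈ G`, taking only finitely many values, with `g_k (x_k … x_1) = y_k … y_1` for all `k`. -/
def AsymptoticallyEquivalent (x y : LeftWord X) : Prop :=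
  ∃ g : ℕ → G, (Set.range g).Finite ∧ ∀ k, 1 ≤ k → g k • x.suffix k = y.suffix k

/-- Asymptotic equivalence as an equivalence relation. -/
def asymptoticSetoid : Setoid (LeftWord X) where
  r := AsymptoticallyEquivalent G X
  iseqv := by
    refine ⟨fun x => ⟨fun _ => 1, ?_, fun k _ => one_smul _ _⟩, ?_, ?_⟩
    · exact (Set.finite_singleton (1 : G)).subset (by rintro _ ⟨_, rfl⟩; rfl)
    · rintro x y ⟨g, hg, h⟩
      refine ⟨fun k => (g k)⁻¹, (hg.image (·⁻¹)).subset ?_, fun k hk => ?_⟩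
      · rintro _ ⟨k, rfl⟩
        exact ⟨g k, ⟨k, rfl⟩, rfl⟩
      · simp only [← h k hk, inv_smul_smul]
    · rintro x y z ⟨g, hg, h⟩ ⟨g', hg', h'⟩
      refine ⟨fun k => g' k * g k, (Set.Finite.image2 (· * ·) hg' hg).subset ?_, fun k hk => ?_⟩
      · rintro _ ⟨k, rfl⟩
        exact ⟨g' k, ⟨k, rfl⟩, g k, ⟨k, rfl⟩, rfl⟩
      · simp only [mul_smul, h k hk, h' k hk]

/-- The limit space `J_G`, with the quotient topology. -/
def LimitSpace : Type _ := Quotient (asymptoticSetoid G X)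

instance : TopologicalSpace (LimitSpace G X) :=
  inferInstanceAs (TopologicalSpace (Quotient (asymptoticSetoid G X)))

/-- The quotient map onto the limit space. -/
def limitMap : LeftWord X → LimitSpace G X := Quotient.mk (asymptoticSetoid G X)

instance [Finite X] : CompactSpace (LimitSpace G X) :=
  inferInstanceAs (CompactSpace (Quotient (asymptoticSetoid G X)))

variable {G X}

theorem limitMap_eq_iff {x y : LeftWord X} :
    limitMap G X x = limitMap G X y ↔ AsymptoticallyEquivalent G X x y :=
  Quotient.eq (r := asymptoticSetoid G X)

theorem smul_append [IsSelfSimilarAction G X] (g : G) (u v : List X) :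
    ∃ u' : List X, u'.length = u.length ∧ g • (u ++ v) = u' ++ restrictWord g u • v := by
  induction u generalizing g with
  | nil => exact ⟨[], rfl, rfl⟩
  | cons a u ih =>
    obtain ⟨u', h1, h2⟩ := ih (restrict g a)
    exact ⟨rootPerm g a :: u', by simp [h1], by simp [smul_cons, h2, restrictWord]⟩

theorem LeftWord.exists_suffix_add (x : LeftWord X) (m k : ℕ) :
    ∃ u : List X, u.length = m ∧ x.suffix (m + k) = u ++ x.suffix k := by
  induction m with
  | zero => exact ⟨[], rfl, by simp⟩
  | succ m ih =>
    obtain ⟨u, h1, h2⟩ := ih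
    refine ⟨x (m + k) :: u, by simp [h1], ?_⟩
    rw [show m + 1 + k = (m + k) + 1 by omega]
    simp [LeftWord.suffix, h2]

theorem asymptoticallyEquivalent_iff [IsSelfSimilarAction G X] [IsContracting G X]
    {x y : LeftWord X} : AsymptoticallyEquivalent G X x y ↔
      ∀ k, ∃ g ∈ nucleus G X, g • x.suffix k = y.suffix k := by
  constructor
  · rintro ⟨g, hg, h⟩ k
    choose m hm using (isLeast_nucleus G X).1.2
    obtain ⟨M, hM⟩ := (hg.image m).bddAbove
    obtain ⟨u, hu, hxu⟩ := x.exists_suffix_add (M + 1) k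
    obtain ⟨v, hv, hyv⟩ := y.exists_suffix_add (M + 1) k
    have hle : m (g (M + 1 + k)) ≤ u.length := by
      have := hM (Set.mem_image_of_mem m (Set.mem_range_self (M + 1 + k)))
      omega
    refine ⟨_, hm _ u hle, ?_⟩
    have := h (M + 1 + k) (by omega)
    obtain ⟨u', hu', hgu⟩ := smul_append (g (M + 1 + k)) u (x.suffix k)
    rw [hxu, hyv, hgu] at this
    exact (List.append_inj this (by omega)).2
  · intro h
    choose g hg hgk using h
    exact ⟨g, (isLeast_nucleus G X).1.1.subset (by rintro _ ⟨k, rfl⟩; exact hg k),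
      fun k _ => hgk k⟩

theorem isClosed_asymptoticallyEquivalent [IsSelfSimilarAction G X] [IsContracting G X] :
    IsClosed {p : LeftWord X × LeftWord X | AsymptoticallyEquivalent G X p.1 p.2} := by
  simp only [asymptoticallyEquivalent_iff, Set.ofPred_forall]
  refine isClosed_iInter fun k => ?_
  let : TopologicalSpace (List X) := ⊥
  have : DiscreteTopology (List X) := ⟨rfl⟩
  have hc : Continuous fun p : LeftWord X × LeftWord X => (p.1.suffix k, p.2.suffix k) :=
    ((LeftWord.isLocallyConstant_suffix k).continuous.comp continuous_fst).prodMk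
      ((LeftWord.isLocallyConstant_suffix k).continuous.comp continuous_snd)
  exact (isClosed_discrete
    {q : List X × List X | ∃ g ∈ nucleus G X, g • q.1 = q.2}).preimage hc

theorem continuous_limitMap : Continuous (limitMap G X) := continuous_quotient_mk'

theorem isQuotientMap_limitMap : IsQuotientMap (limitMap G X) := isQuotientMap_quotient_mk'

theorem isClosedMap_limitMap [Finite X] [IsSelfSimilarAction G X] [IsContracting G X] :
    IsClosedMap (limitMap G X) := by
  intro C hC
  rw [← isQuotientMap_limitMap.isClosed_preimage]
  have : limitMap G X ⁻¹' (limitMap G X '' C) = Prod.snd ''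
      ({p : LeftWord X × LeftWord X | AsymptoticallyEquivalent G X p.1 p.2} ∩
        Prod.fst ⁻¹' C) := by
    ext y
    constructor
    · rintro ⟨x, hx, hxy⟩
      exact ⟨(x, y), ⟨limitMap_eq_iff.1 hxy, hx⟩, rfl⟩
    · rintro ⟨⟨x, y'⟩, ⟨hxy, hx⟩, rfl⟩
      exact ⟨x, hx, limitMap_eq_iff.2 hxy⟩
  rw [this]
  exact ((isClosed_asymptoticallyEquivalent.inter
    (hC.preimage continuous_fst)).isCompact.image continuous_snd).isClosed

/-- The limit space of a contracting action over a finite alphabet is metrizable. -/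
instance [Finite X] [IsSelfSimilarAction G X] [IsContracting G X] :
    TopologicalSpace.MetrizableSpace (LimitSpace G X) := by
  have hq := isClosedMap_limitMap (G := G) (X := X)
  have hcont := continuous_limitMap (G := G) (X := X)
  have hsurj : Function.Surjective (limitMap G X) := Quotient.mk_surjective
  -- the largest saturated subset of an open set, seen in the quotient, is open
  have hopen : ∀ U : Set (LeftWord X), IsOpen U → IsOpen (limitMap G X '' Uᶜ)ᶜ := fun U hU =>
    (hq _ hU.isClosed_compl).isOpen_compl
  have hmem : ∀ (U : Set (LeftWord X)) (a : LimitSpace G X),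
      a ∈ (limitMap G X '' Uᶜ)ᶜ ↔ limitMap G X ⁻¹' {a} ⊆ U := by
    intro U a
    constructor
    · intro h x hx
      by_contra hxU
      exact h ⟨x, hxU, hx⟩
    · rintro h ⟨x, hxU, hx⟩
      exact hxU (h hx)
  have hT1 : ∀ a : LimitSpace G X, IsClosed ({a} : Set (LimitSpace G X)) := by
    intro a
    obtain ⟨x, rfl⟩ := hsurj a
    simpa using hq {x} isClosed_singleton
  have : T2Space (LimitSpace G X) := by
    refine ⟨fun a b hab => ?_⟩
    have hd : Disjoint (limitMap G X ⁻¹' {a}) (limitMap G X ⁻¹' {b}) :=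
      Disjoint.preimage _ (by simpa using hab)
    obtain ⟨U, V, hU, hV, haU, hbV, hUV⟩ :=
      normal_separation ((hT1 a).preimage hcont) ((hT1 b).preimage hcont) hd
    refine ⟨_, _, hopen U hU, hopen V hV, (hmem U a).2 haU, (hmem V b).2 hbV, ?_⟩
    rw [Set.disjoint_left]
    intro c hcU hcV
    obtain ⟨x, rfl⟩ := hsurj c
    exact Set.disjoint_left.1 hUV ((hmem U _).1 hcU rfl) ((hmem V _).1 hcV rfl)
  have : SecondCountableTopology (LimitSpace G X) := by
    obtain ⟨B, hBc, -, hB⟩ := TopologicalSpace.exists_countable_basis (LeftWord X)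
    have hfin : {F : Set (Set (LeftWord X)) | F.Finite ∧ F ⊆ B}.Countable :=
      Set.countable_ofPred_finite_subset hBc
    have hbasis : TopologicalSpace.IsTopologicalBasis
        ((fun F : Set (Set (LeftWord X)) => (limitMap G X '' (⋃₀ F)ᶜ)ᶜ) ''
          {F | F.Finite ∧ F ⊆ B}) := by
      refine TopologicalSpace.isTopologicalBasis_of_isOpen_of_nhds ?_ ?_
      · rintro _ ⟨F, ⟨_, hF⟩, rfl⟩
        exact hopen _ (isOpen_sUnion fun s hs => hB.isOpen (hF hs))
      · intro a W ha hW
        have hK : IsCompact (limitMap G X ⁻¹' {a}) := ((hT1 a).preimage hcont).isCompact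
        have hKW : limitMap G X ⁻¹' {a} ⊆ limitMap G X ⁻¹' W := by
          rintro x rfl
          exact ha
        obtain ⟨S, hSB, hS⟩ := hB.open_eq_sUnion (hW.preimage hcont)
        rw [hS, Set.sUnion_eq_biUnion] at hKW
        obtain ⟨F, hFS, hFfin, hKF⟩ :=
          hK.elim_finite_subcover_image (fun s hs => hB.isOpen (hSB hs)) hKW
        rw [← Set.sUnion_eq_biUnion] at hKF
        exact ⟨_, ⟨F, ⟨hFfin, hFS.trans hSB⟩, rfl⟩, (hmem _ a).2 hKF, by
          intro c hc
          obtain ⟨x, rfl⟩ := hsurj c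
          have hx : x ∈ ⋃₀ F := (hmem _ _).1 hc rfl
          have : x ∈ limitMap G X ⁻¹' W := hS ▸ Set.sUnion_subset_sUnion hFS hx
          exact this⟩
    exact hbasis.secondCountableTopology (hfin.image _)
  exact TopologicalSpace.metrizableSpace_of_t3_secondCountable _

end LimitSpace

/-! ## Self-similar structures -/

section Structures

/-- A self-similar structure on a compact metrizable space `K`: continuous injections
`F i : K → K` for `i ∈ X` and a continuous surjection `π` from the left-infinite words onto `K`
with `F i ∘ π = π ∘ i`, where `i` appends the letter `i`.  The surjection, which is unique for
given `F`, is recorded as part of the data. -/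
structure SelfSimilarStructure (K X : Type*) [TopologicalSpace K] [CompactSpace K]
    [TopologicalSpace.MetrizableSpace K] where
  F : X → K → K
  continuous_F : ∀ i, Continuous (F i)
  injective_F : ∀ i, Function.Injective (F i)
  π : LeftWord X → K
  continuous_π : Continuous π
  surjective_π : Function.Surjective π
  F_comp_π : ∀ i, F i ∘ π = π ∘ LeftWord.append i

variable {K X : Type*} [TopologicalSpace K] [CompactSpace K] [TopologicalSpace.MetrizableSpace K]

namespace SelfSimilarStructure

/-- The first level cell `K_i = F_i(K)`. -/
def cell (L : SelfSimilarStructure K X) (i : X) : Set K := Set.range (L.F i)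

/-- The critical set, the preimage under `π` of the union of the `K_i ∩ K_j` with `i ≠ j`. -/
def criticalSet (L : SelfSimilarStructure K X) : Set (LeftWord X) :=
  L.π ⁻¹' (⋃ (i : X) (j : X) (_ : i ≠ j), L.cell i ∩ L.cell j)

/-- The post-critical set, the union of the images of the critical set under the positive powers
of the shift. -/
def postCriticalSet (L : SelfSimilarStructure K X) : Set (LeftWord X) :=
  ⋃ (n : ℕ) (_ : 1 ≤ n), LeftWord.shift^[n] '' L.criticalSet

/-- A self-similar structure is post-critically finite if its post-critical set is finite. -/
def IsPostCriticallyFinite (L : SelfSimilarStructure K X) : Prop := L.postCriticalSet.Finite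

end SelfSimilarStructure

end Structures

end SelfSimilar

/-! The post-critical words are exactly the words read by left-infinite paths in the nucleus that
end at a non-trivial state, and each word is read by only finitely many paths.

If a path ends at `q ≠ 1`, faithfulness gives a finite word moved by `q`. Prolong the path along
this word up to the first moved letter: the input and output words are asymptotically equivalent and
differ in their last letter, so the input is critical and the original word is a shift of it
(`mem_postCriticalSet_of_isStateSequence`). Conversely, a critical word is equivalent to a word with
another last letter; König's lemma produces a path in the nucleus relating them, and the state
reading that last letter, hence every state before it, is non-trivial
(`exists_path_of_mem_postCriticalSet`).

The fibres are finite because the Moore diagram is deterministic: a state and the letters read after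
it determine all later states (`finite_leftInfinitePaths_letter_eq`). -/

namespace SelfSimilar

/-! ### Restrictions and the nucleus -/

section Restrictions

variable {G X : Type*} [Group G] [MulAction G (List X)] [IsSelfSimilarAction G X]

theorem restrict_one (x : X) : restrict (1 : G) x = 1 :=
  (restrict_unique (g := (1 : G)) (h := 1) (y := x) fun w => by simp).2.symm

theorem rootPerm_one (x : X) : rootPerm (1 : G) x = x :=
  (restrict_unique (g := (1 : G)) (h := 1) (y := x) fun w => by simp).1.symm

theorem restrictWord_append (g : G) (u v : List X) :
    restrictWord g (u ++ v) = restrictWord (restrictWord g u) v := by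
  induction u generalizing g with
  | nil => rfl
  | cons a u ih => exact ih _

variable [IsContracting G X]

/-- The nucleus is closed under restrictions. -/
theorem restrict_mem_nucleus {g : G} (hg : g ∈ nucleus G X) (x : X) :
    restrict g x ∈ nucleus G X := by
  have hN := (isLeast_nucleus G X).1
  -- By minimality it suffices that the elements with all restrictions in the nucleus still absorb:
  -- the bound `k` for `w` also serves every extension `w ++ v`.
  have hS : {g ∈ nucleus G X | ∀ w : List X, restrictWord g w ∈ nucleus G X} ∈
      {N : Set G | N.Finite ∧ Absorbs X N} := by
    refine ⟨hN.1.subset fun g hg => hg.1, fun g => ?_⟩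
    obtain ⟨k, hk⟩ := hN.2 g
    refine ⟨k, fun w hw => ⟨hk w hw, fun v => ?_⟩⟩
    rw [← restrictWord_append]
    exact hk _ (by rw [List.length_append]; omega)
  exact ((isLeast_nucleus G X).2 hS hg).2 [x]

end Restrictions

/-! ### Paths in the Moore diagram -/

section StateSequences

variable {G X : Type*} [Group G] [MulAction G (List X)] [IsSelfSimilarAction G X]

/-- The states `… q_1 q_0` visited by a left-infinite path in the Moore diagram of `S` that reads
the word `x`; the path ends at `q 0`. -/
def IsStateSequence (S : Set G) (x : LeftWord X) (q : ℕ → G) : Prop :=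
  ∀ n, q n ∈ S ∧ restrict (q (n + 1)) (x n) = q n

namespace IsStateSequence

variable {S : Set G} {x : LeftWord X} {q : ℕ → G}

theorem smul_suffix (h : IsStateSequence S x q) (k : ℕ) :
    q k • x.suffix k = LeftWord.suffix (fun n => rootPerm (q (n + 1)) (x n)) k := by
  induction k with
  | zero => exact IsSelfSimilarAction.smul_nil _
  | succ k ih => rw [LeftWord.suffix, smul_cons, (h k).2, ih]; rfl

/-- The states of the path themselves serve as the group elements `g_k`. -/
theorem asymptoticallyEquivalent (h : IsStateSequence S x q) (hS : S.Finite) :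
    AsymptoticallyEquivalent G X x (fun n => rootPerm (q (n + 1)) (x n)) :=
  ⟨q, hS.subset (Set.range_subset_iff.2 fun n => (h n).1), fun k _ => h.smul_suffix k⟩

theorem append (h : IsStateSequence S x q) {a : X} (ha : restrict (q 0) a ∈ S) :
    IsStateSequence S (x.append a) (fun n => Nat.casesOn n (restrict (q 0) a) q)
  | 0 => ⟨ha, rfl⟩
  | n + 1 => h n

/-- Restrictions of the identity are trivial, so a path never leaves the trivial state; larger
indices are visited earlier. -/
theorem ne_one (h : IsStateSequence S x q) {n m : ℕ} (hnm : n ≤ m) (hn : q n ≠ 1) : q m ≠ 1 := by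
  induction m, hnm using Nat.le_induction with
  | base => exact hn
  | succ m _ ih =>
    intro h1
    apply ih
    rw [← (h m).2, h1, restrict_one]

/-- The path with a given sequence of states. -/
def path (h : IsStateSequence S x q) (n : ℕ) : MooreArrow X S :=
  ⟨q (n + 1), x n, (h (n + 1)).1, (h n).2 ▸ (h n).1⟩

theorem path_mem (h : IsStateSequence S x q) : h.path ∈ leftInfinitePaths X S :=
  fun n => (h (n + 1)).2

end IsStateSequence

/-- The sequence of states of a path. -/
theorem isStateSequence_of_mem_leftInfinitePaths {S : Set G} {e : ℕ → MooreArrow X S}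
    (he : e ∈ leftInfinitePaths X S) :
    IsStateSequence S (fun n => (e n).letter) (fun n => (e n).target) :=
  fun n => ⟨(e n).restrict_mem, congrArg (restrict · (e n).letter) (he n)⟩

/-- Asymptotically equivalent words are the labels of a left-infinite path in the nucleus. -/
theorem AsymptoticallyEquivalent.exists_isStateSequence [IsContracting G X] {x y : LeftWord X}
    (h : AsymptoticallyEquivalent G X x y) :
    ∃ q : ℕ → G, IsStateSequence (nucleus G X) x q ∧ ∀ n, rootPerm (q (n + 1)) (x n) = y n := by
  rw [asymptoticallyEquivalent_iff] at h
  have hstep : ∀ (n : ℕ) (g : G), g • x.suffix (n + 1) = y.suffix (n + 1) →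
      rootPerm g (x n) = y n ∧ restrict g (x n) • x.suffix n = y.suffix n := fun n g hg => by
    rw [LeftWord.suffix, smul_cons] at hg
    exact List.cons.inj hg
  -- König's lemma: the nucleus elements that match the suffixes of length `n` form finite non-empty
  -- sets, and restriction by `x n` makes them an inverse system. A section is a sequence of states.
  let A : ℕ → Type _ := fun n => {g : G // g ∈ nucleus G X ∧ g • x.suffix n = y.suffix n}
  let f : ∀ n, A (n + 1) → A n := fun n g =>
    ⟨restrict g.1 (x n), restrict_mem_nucleus g.2.1 _, (hstep n _ g.2.2).2⟩
  let F := CategoryTheory.Functor.ofOpSequence (X := A) fun n => TypeCat.ofHom (f n)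
  have hne : ∀ n, Nonempty (F.obj n) := fun n =>
    let ⟨g, hg⟩ := h n.unop
    ⟨⟨g, hg⟩⟩
  have hfin : ∀ n, Finite (F.obj n) := fun n =>
    ((isLeast_nucleus G X).1.1.subset fun _ hg => hg.1 :
      {g : G | g ∈ nucleus G X ∧ g • x.suffix n.unop = y.suffix n.unop}.Finite).to_subtype
  obtain ⟨s, hs⟩ := nonempty_sections_of_finite_inverse_system F
  let q : ∀ n, A n := fun n => s (Opposite.op n)
  have hq : ∀ n, f n (q (n + 1)) = q n := fun n => by
    have := hs (CategoryTheory.homOfLE (Nat.le_add_right n 1)).op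
    rw [CategoryTheory.Functor.ofOpSequence_map_homOfLE_succ] at this
    exact this
  exact ⟨fun n => (q n).1, fun n => ⟨(q n).2.1, congrArg Subtype.val (hq n)⟩,
    fun n => (hstep n _ (q (n + 1)).2.2).1⟩

/-- In the Moore diagram of a finite set only finitely many left-infinite paths read a given
word. -/
theorem finite_leftInfinitePaths_letter_eq {S : Set G} (hS : S.Finite) (x : LeftWord X) :
    {e ∈ leftInfinitePaths X S | (fun n => (e n).letter) = x}.Finite := by
  classical
  by_contra hinf
  obtain ⟨T, hT, hcard⟩ := Set.Infinite.exists_subset_card_eq hinf (hS.toFinset.card + 1)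
  -- Once the sources of two paths reading `x` differ at `n`, determinism makes them differ at every
  -- larger index. So at some common index all paths of `T` have distinct sources, too many for `S`.
  have hsep : ∀ e ∈ T, ∀ e' ∈ T, ∀ᶠ n in Filter.atTop,
      (e n).source = (e' n).source → e = e' := by
    intro e he e' he'
    obtain ⟨hp, hl⟩ := hT he
    obtain ⟨hp', hl'⟩ := hT he'
    have hlet : ∀ n, (e n).letter = (e' n).letter := congrFun (hl.trans hl'.symm)
    by_cases hee : e = e'
    · exact Filter.Eventually.of_forall fun _ _ => hee
    obtain ⟨n, hn⟩ : ∃ n, (e n).source ≠ (e' n).source := by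
      by_contra! hall
      exact hee (funext fun n => MooreArrow.ext (hall n) (hlet n))
    filter_upwards [Filter.eventually_ge_atTop n] with m hm hsrc
    refine absurd hsrc ?_
    clear hsrc
    induction m, hm using Nat.le_induction with
    | base => exact hn
    | succ m _ ih =>
      intro h
      apply ih
      rw [← hp m, ← hp' m, MooreArrow.target, MooreArrow.target, h, hlet]
  obtain ⟨n, hn⟩ := ((Filter.eventually_all_finset T).2 fun e he =>
    (Filter.eventually_all_finset T).2 fun e' he' => hsep e he e' he').exists
  have := Finset.card_le_card_of_injOn (s := T) (t := hS.toFinset) (fun e => (e n).source)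
    (fun e _ => by simpa using (e n).source_mem) (fun e he e' he' => hn e he e' he')
  omega

end StateSequences

theorem LeftWord.append_shift {X : Type*} (x : LeftWord X) : x.shift.append (x 0) = x := by
  funext n
  cases n <;> rfl

theorem LeftWord.iterate_shift {X : Type*} (x : LeftWord X) (n : ℕ) :
    LeftWord.shift^[n] x = fun k => x (k + n) := by
  induction n with
  | zero => rfl
  | succ n ih =>
    rw [Function.iterate_succ_apply', ih]
    funext k
    exact congrArg x (by omega)

/-! ### Post-critical words and paths -/

namespace SelfSimilarStructure

section General

variable {K X : Type*} [TopologicalSpace K] [CompactSpace K] [TopologicalSpace.MetrizableSpace K]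
  (L : SelfSimilarStructure K X)

theorem mem_criticalSet_iff {x : LeftWord X} :
    x ∈ L.criticalSet ↔ ∃ y : LeftWord X, L.π x = L.π y ∧ x 0 ≠ y 0 := by
  have hF : ∀ (i : X) (u : LeftWord X), L.F i (L.π u) = L.π (u.append i) :=
    fun i => congrFun (L.F_comp_π i)
  have hcell : ∀ (i : X) (a : K), a ∈ L.cell i ↔ ∃ u : LeftWord X, L.π (u.append i) = a := by
    intro i a
    constructor
    · rintro ⟨b, rfl⟩
      obtain ⟨u, rfl⟩ := L.surjective_π b
      exact ⟨u, (hF i u).symm⟩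
    · rintro ⟨u, rfl⟩
      exact ⟨_, hF i u⟩
  simp only [criticalSet, Set.mem_preimage, Set.mem_iUnion, Set.mem_inter_iff, hcell, exists_prop]
  constructor
  · rintro ⟨i, j, hij, ⟨u, hu⟩, v, hv⟩
    -- Since `i ≠ j`, at least one of the two representatives has a last letter other than `x 0`.
    by_cases hi : x 0 = i
    · exact ⟨_, hv.symm, fun h => hij (hi.symm.trans h)⟩
    · exact ⟨_, hu.symm, hi⟩
  · rintro ⟨y, hxy, hne⟩
    exact ⟨x 0, y 0, hne, ⟨x.shift, by rw [x.append_shift]⟩, y.shift, by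
      rw [y.append_shift, hxy]⟩

theorem mem_postCriticalSet_iff {x : LeftWord X} :
    x ∈ L.postCriticalSet ↔ ∃ n, 1 ≤ n ∧ ∃ c ∈ L.criticalSet, LeftWord.shift^[n] c = x := by
  simp [postCriticalSet]

theorem mem_postCriticalSet_of_append_mem_criticalSet {x : LeftWord X} {a : X}
    (h : x.append a ∈ L.criticalSet) : x ∈ L.postCriticalSet :=
  L.mem_postCriticalSet_iff.2 ⟨1, le_rfl, _, h, rfl⟩

theorem mem_postCriticalSet_of_append_mem {x : LeftWord X} {a : X}
    (h : x.append a ∈ L.postCriticalSet) : x ∈ L.postCriticalSet := by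
  obtain ⟨n, -, c, hc, hcx⟩ := L.mem_postCriticalSet_iff.1 h
  refine L.mem_postCriticalSet_iff.2 ⟨n + 1, by omega, c, hc, ?_⟩
  rw [Function.iterate_succ_apply', hcx]
  rfl

end General

variable {G X : Type*} [Group G] [Finite X] [MulAction G (List X)]
  [IsSelfSimilarAction G X] [IsContracting G X]
  {L : SelfSimilarStructure (LimitSpace G X) X}

/-- A word read by a path in the nucleus that ends at a non-trivial state is post-critical. -/
theorem mem_postCriticalSet_of_isStateSequence (hL : L.π = limitMap G X) (w : List X)
    {x : LeftWord X} {q : ℕ → G} (hq : IsStateSequence (nucleus G X) x q) (hw : q 0 • w ≠ w) :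
    x ∈ L.postCriticalSet := by
  induction w generalizing x q with
  | nil => exact absurd (IsSelfSimilarAction.smul_nil _) hw
  | cons a w ih =>
    have hq' := hq.append (restrict_mem_nucleus (hq 0).1 a)
    -- If `a` is fixed, the restriction of `q 0` at `a` must move the rest `w`, and the prolonged
    -- path is handled by induction. Otherwise the output of the prolonged path is an equivalent
    -- word whose last letter differs from `a`.
    by_cases ha : rootPerm (q 0) a = a
    · refine L.mem_postCriticalSet_of_append_mem (ih hq' fun h => hw ?_)
      rw [smul_cons, ha]
      exact congrArg _ h
    · refine L.mem_postCriticalSet_of_append_mem_criticalSet (a := a) (L.mem_criticalSet_iff.2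
        ⟨fun n => rootPerm (q n) (x.append a n), ?_, Ne.symm ha⟩)
      rw [hL]
      exact limitMap_eq_iff.2 (hq'.asymptoticallyEquivalent (isLeast_nucleus G X).1.1)

/-- The post-critical words are read by paths in the nucleus that end at non-trivial states. -/
theorem exists_path_of_mem_postCriticalSet (hL : L.π = limitMap G X) {x : LeftWord X}
    (hx : x ∈ L.postCriticalSet) :
    ∃ e ∈ leftInfinitePaths X (nucleus G X), (e 0).target ≠ 1 ∧ (fun n => (e n).letter) = x := by
  obtain ⟨n, hn, c, hc, rfl⟩ := L.mem_postCriticalSet_iff.1 hx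
  obtain ⟨y, hcy, hne⟩ := L.mem_criticalSet_iff.1 hc
  rw [hL, limitMap_eq_iff] at hcy
  obtain ⟨q, hq, hy⟩ := hcy.exists_isStateSequence
  -- The state `q 1` reads `c 0` and moves it. Nothing is claimed about `q 0`, which is why at least
  -- one shift is needed.
  have h1 : q 1 ≠ 1 := fun h => hne (by rw [← hy 0, h, rootPerm_one])
  -- Dropping the last `n` arrows leaves a path that ends at `q n`.
  have hshift : IsStateSequence (nucleus G X) (LeftWord.shift^[n] c) (fun k => q (k + n)) := by
    intro k
    refine ⟨(hq _).1, ?_⟩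
    rw [LeftWord.iterate_shift]
    have := (hq (k + n)).2
    rwa [show k + n + 1 = k + 1 + n by omega] at this
  refine ⟨hshift.path, hshift.path_mem, ?_, rfl⟩
  have : (hshift.path 0).target = q (0 + n) := (hshift 0).2
  rw [this, Nat.zero_add]
  exact hq.ne_one hn h1

end SelfSimilarStructure

end SelfSimilar

/-! ### The equivalence -/

theorem mainTheorem2 {G X : Type*} [Group G] [Finite X] [MulAction G (List X)]
    [SelfSimilar.IsSelfSimilarAction G X] [SelfSimilar.IsContracting G X]
    (L : SelfSimilar.SelfSimilarStructure (SelfSimilar.LimitSpace G X) X)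
    (hL : L.π = SelfSimilar.limitMap G X) :
    L.IsPostCriticallyFinite ↔ SelfSimilar.IsPostCriticallyFiniteAction G X := by
  constructor
  · intro h
    -- The paths are sorted by the post-critical word they read; finitely many words, each with a
    -- finite fibre.
    refine (h.biUnion fun x _ => SelfSimilar.finite_leftInfinitePaths_letter_eq
      (SelfSimilar.isLeast_nucleus G X).1.1 x).subset ?_
    rintro e ⟨he, hne⟩
    obtain ⟨w, hw⟩ : ∃ w : List X, (e 0).target • w ≠ w := by
      by_contra! hw
      exact hne (FaithfulSMul.eq_of_smul_eq_smul fun w => (hw w).trans (one_smul G w).symm)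
    exact Set.mem_biUnion (SelfSimilar.SelfSimilarStructure.mem_postCriticalSet_of_isStateSequence
      hL w (SelfSimilar.isStateSequence_of_mem_leftInfinitePaths he) hw) ⟨he, rfl⟩
  · intro h
    refine (h.image fun e n => (e n).letter).subset fun x hx => ?_
    obtain ⟨e, he, hne, hex⟩ :=
      SelfSimilar.SelfSimilarStructure.exists_path_of_mem_postCriticalSet hL hx
    exact ⟨e, ⟨he, hne⟩, hex⟩
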